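/- Let $A,B,A',B'$ be nonzero finite-dimensional complex Hilbert spaces. For such spaces $I,O$ write $\mathrm{L}(I)$ for the linear operators on $I$, $\mathrm{T}(I\to O)$ for the linear maps $\mathrm{L}(I)\to\mathrm{L}(O)$, $\mathrm{HP}(I\to O)\subset\mathrm{T}(I\to O)$ for the Hermitian-preserving ones, $\mathrm{CP}(I\to O)$ for the completely positive ones and $\mathrm{CPTP}(I\to O)$ for the completely positive trace-preserving ones. A discrete quantum instrument from $I$ to $O$ is a finite or countable family $(\mathcal E_i)_i$ of nonzero maps in $\mathrm{CP}(I\to O)$ with $\sum_i\mathcal E_i\in\mathrm{CPTP}(I\to O)$. Let $\mathrm{QI}_{\mathrm{LO}}$ be the set of all families $(\mathcal E_i\otimes\mathcal F_j)_{i,j}$ with $(\mathcal E_i)_i$ a discrete quantum instrument from $A$ to $A'$ and $(\mathcal F_j)_j$ one from $B$ to $B'$, and put $$\mathrm{LO}=\Big\{\sum_k\mathcal G_k:(\mathcal G_k)_k\in\mathrm{QI}_{\mathrm{LO}}\Big\},\qquad \mathrm{LO}^\star=\Big\{\sum_k w_k\,\mathcal G_k:(\mathcal G_k)_k\in\mathrm{QI}_{\mathrm{LO}},\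 w_k\in[-1,1]\Big\}.$$ For $S\subset\mathrm{T}(AB\to A'B')$ and $\mathcal E\in\mathrm{T}(AB\to A'B')$ let $$\gamma_S(\mathcal E)=\inf\Big\{\sum_{i=1}^m|c_i| : \mathcal E=\sum_{i=1}^m c_i\mathcal F_i,\ m\ge1,\ \mathcal F_i\in S,\ c_i\in\mathbb R\Big\}\in[0,\infty],$$ with $\inf\emptyset=\infty$. Let $\mathrm{NSIG}$ be the set of non-signalling maps, i.e. of those $\mathcal E\in\mathrm{HP}(AB\to A'B')$ such that for all density operators $\rho,\sigma$ on $AB$: if $\mathrm{tr}_B\rho=\mathrm{tr}_B\sigma$ then $\mathrm{tr}_{B'}\mathcal E(\rho)=\mathrm{tr}_{B'}\mathcal E(\sigma)$, and if $\mathrm{tr}_A\rho=\mathrm{tr}_A\sigma$ then $\mathrm{tr}_{A'}\mathcal E(\rho)=\mathrm{tr}_{A'}\mathcal E(\sigma)$. Then $$\mathrm{span}_{\mathbb R}(\mathrm{LO})=\mathrm{NSIG},\qquad \mathrm{span}_{\mathbb R}(\mathrm{LO}^\star)=\mathrm{HP}(AB\to A'B').$$ Consequently, for $\mathcal E\in\mathrm{T}(AB\to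 A'B')$, $\gamma_{\mathrm{LO}}(\mathcal E)<\infty$ if and only if $\mathcal E\in\mathrm{NSIG}$, and $\gamma_{\mathrm{LO}^\star}(\mathcal E)<\infty$ if and only if $\mathcal E\in\mathrm{HP}(AB\to A'B')$; in particular $\gamma_{\mathrm{LO}^\star}(\mathcal E)<\infty$ for every $\mathcal E\in\mathrm{CPTP}(AB\to A'B')$. -/

import Mathlib

open scoped Kronecker ComplexOrder

namespace CircuitCutting

/-- `T(I → O)`: linear superoperators, for `I = ℂ^m` and `O = ℂ^n` (operators are matrices). -/
abbrev Superop (m n : Type*) := Matrix m m ℂ →ₗ[ℂ] Matrix n n ℂ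

section Basic

variable {m n : Type*} [Fintype m] [Fintype n]

/-- Density matrices. -/
def IsDensity (ρ : Matrix m m ℂ) : Prop := ρ.PosSemidef ∧ ρ.trace = 1

/-- Hermitian-preserving superoperators. -/
def HP (m n : Type*) : Set (Superop m n) :=
  {E | ∀ X : Matrix m m ℂ, X.IsHermitian → (E X).IsHermitian}

/-- Trace-preserving superoperators. -/
def TP (m n : Type*) [Fintype m] [Fintype n] : Set (Superop m n) :=
  {E | ∀ X : Matrix m m ℂ, (E X).trace = X.trace}

/-- `(id_k ⊗ E)(M)`: the map `E` is applied to every `m × m` block of `M`. -/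
def ampliation (k : ℕ) (E : Superop m n) (M : Matrix (Fin k × m) (Fin k × m) ℂ) :
    Matrix (Fin k × n) (Fin k × n) ℂ :=
  Matrix.of fun x y => E (Matrix.of fun p q => M (x.1, p) (y.1, q)) x.2 y.2

/-- Completely positive superoperators: `id_k ⊗ E` is positive for every `k`. -/
def CP (m n : Type*) [Fintype m] [Fintype n] : Set (Superop m n) :=
  {E | ∀ (k : ℕ) (M : Matrix (Fin k × m) (Fin k × m) ℂ),
    M.PosSemidef → (ampliation k E M).PosSemidef}

/-- Quantum channels. -/
def CPTP (m n : Type*) [Fintype m] [Fintype n] : Set (Superop m n) := CP m n ∩ TP m n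

end Basic

section Bipartite

variable {a b a' b' : Type*}

/-- `tr_B : L(AB) → L(A)`. -/
def traceB [Fintype b] (X : Matrix (a × b) (a × b) ℂ) : Matrix a a ℂ :=
  Matrix.of fun i j => ∑ k, X (i, k) (j, k)

/-- `tr_A : L(AB) → L(B)`. -/
def traceA [Fintype a] (X : Matrix (a × b) (a × b) ℂ) : Matrix b b ℂ :=
  Matrix.of fun k l => ∑ i, X (i, k) (i, l)

variable [Fintype a] [Fintype b] [DecidableEq a] [DecidableEq b]

/-- The tensor product `E ⊗ F` of superoperators: `X = ∑ X_{(p,r),(q,s)} e_{pq} ⊗ e_{rs}` is sent to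
`∑ X_{(p,r),(q,s)} E(e_{pq}) ⊗ F(e_{rs})`. -/
noncomputable def tensor (E : Superop a a') (F : Superop b b') : Superop (a × b) (a' × b') where
  toFun X := ∑ p : a, ∑ q : a, ∑ r : b, ∑ s : b,
    X (p, r) (q, s) • (E (Matrix.single p q 1) ⊗ₖ F (Matrix.single r s 1))
  map_add' X Y := by
    simp only [Matrix.add_apply, add_smul, Finset.sum_add_distrib]
  map_smul' c X := by
    simp only [Matrix.smul_apply, smul_eq_mul, mul_smul, Finset.smul_sum, RingHom.id_apply]

/-- Sanity check of the definition: it is characterised by its action on product operators. -/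
theorem tensor_kronecker (E : Superop a a') (F : Superop b b')
    (X : Matrix a a ℂ) (Y : Matrix b b ℂ) : tensor E F (X ⊗ₖ Y) = E X ⊗ₖ F Y := by
  have hX : E X = ∑ p, ∑ q, X p q • E (Matrix.single p q 1) := by
    conv_lhs => rw [Matrix.matrix_eq_sum_single X]
    simp only [map_sum]
    refine Finset.sum_congr rfl fun p _ => Finset.sum_congr rfl fun q _ => ?_
    rw [← map_smul, Matrix.smul_single, smul_eq_mul, mul_one]
  have hY : F Y = ∑ r, ∑ s, Y r s • F (Matrix.single r s 1) := by
    conv_lhs => rw [Matrix.matrix_eq_sum_single Y]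
    simp only [map_sum]
    refine Finset.sum_congr rfl fun p _ => Finset.sum_congr rfl fun q _ => ?_
    rw [← map_smul, Matrix.smul_single, smul_eq_mul, mul_one]
  ext x y
  simp only [tensor, LinearMap.coe_mk, AddHom.coe_mk, Matrix.kroneckerMap_apply, hX, hY,
    Matrix.sum_apply, Matrix.smul_apply, smul_eq_mul]
  simp only [Finset.sum_mul]
  simp only [Finset.mul_sum]
  refine Finset.sum_congr rfl fun p _ => Finset.sum_congr rfl fun q _ =>
    Finset.sum_congr rfl fun r _ => Finset.sum_congr rfl fun s _ => ?_
  ring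

end Bipartite

/-- A discrete (finite or countably infinite) family of superoperators. -/
structure Family (m n : Type*) where
  /-- the set of outcomes -/
  ι : Type
  countable : Countable ι
  /-- the superoperator of each outcome -/
  map : ι → Superop m n

/-- `G` sums to `E`, in the usual topology of the finite-dimensional space `L(O)` at every input. -/
def Family.SumsTo {m n : Type*} (G : Family m n) (E : Superop m n) : Prop :=
  ∀ X : Matrix m m ℂ, HasSum (fun i => G.map i X) (E X)

/-- `(w_i G_i)_i` for real weights `w_i`. -/
noncomputable def Family.weight {m n : Type*} (G : Family m n) (w : G.ι → ℝ) : Family m n where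
  ι := G.ι
  countable := G.countable
  map i := w i • G.map i

/-- `(E_i ⊗ F_j)_{i,j}`. -/
noncomputable def Family.tensor {a b a' b' : Type*} [Fintype a] [Fintype b]
    [DecidableEq a] [DecidableEq b] (E : Family a a') (F : Family b b') :
    Family (a × b) (a' × b') where
  ι := E.ι × F.ι
  countable := by
    have := E.countable
    have := F.countable
    infer_instance
  map x := CircuitCutting.tensor (E.map x.1) (F.map x.2)

/-- Discrete quantum instruments: discrete families of nonzero completely positive maps whose sum
is a quantum channel. -/
def QI (m n : Type*) [Fintype m] [Fintype n] : Set (Family m n) :=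
  {G | (∀ i, G.map i ∈ CP m n ∧ G.map i ≠ 0) ∧ ∃ E ∈ CPTP m n, G.SumsTo E}

/-- The channels `∑ G_i` induced by a set `Q` of instruments. -/
def inducedChannels {m n : Type*} (Q : Set (Family m n)) : Set (Superop m n) :=
  {E | ∃ G ∈ Q, G.SumsTo E}

/-- `𝓛[Q]`: the maps `∑ w_i G_i` with `(G_i)_i ∈ Q` and weights `w_i ∈ [-1, 1]`. -/
def sideInfo {m n : Type*} (Q : Set (Family m n)) : Set (Superop m n) :=
  {E | ∃ G ∈ Q, ∃ w : G.ι → ℝ, (∀ i, w i ∈ Set.Icc (-1 : ℝ) 1) ∧ (G.weight w).SumsTo E}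

section Local

variable (a b a' b' : Type*) [Fintype a] [Fintype b] [Fintype a'] [Fintype b']
  [DecidableEq a] [DecidableEq b]

/-- Product instruments `(E_i ⊗ F_j)_{i,j}` of local instruments. -/
def QILO : Set (Family (a × b) (a' × b')) :=
  {G | ∃ E ∈ QI a a', ∃ F ∈ QI b b', G = E.tensor F}

/-- Local operations. -/
def LO : Set (Superop (a × b) (a' × b')) := inducedChannels (QILO a b a' b')

/-- Local operations with classical side information. -/
def LOStar : Set (Superop (a × b) (a' × b')) := sideInfo (QILO a b a' b')

/-- Non-signalling Hermitian-preserving maps: the output on either side depends only on the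
input on that side. -/
def NSIG (a b a' b' : Type*) [Fintype a] [Fintype b] [Fintype a'] [Fintype b'] :
    Set (Superop (a × b) (a' × b')) :=
  {E | E ∈ HP (a × b) (a' × b') ∧
    (∀ ρ σ : Matrix (a × b) (a × b) ℂ, IsDensity ρ → IsDensity σ →
      traceB ρ = traceB σ → traceB (E ρ) = traceB (E σ)) ∧
    (∀ ρ σ : Matrix (a × b) (a × b) ℂ, IsDensity ρ → IsDensity σ →
      traceA ρ = traceA σ → traceA (E ρ) = traceA (E σ))}

end Local

/-- The quasiprobability extent `γ_S(E)`; the infimum over the empty set is `∞`. -/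
noncomputable def extent {m n : Type*} (S : Set (Superop m n)) (E : Superop m n) : ENNReal :=
  sInf {t | ∃ (k : ℕ) (c : Fin k → ℝ) (F : Fin k → Superop m n), 1 ≤ k ∧ (∀ i, F i ∈ S) ∧
    E = ∑ i, c i • F i ∧ t = ENNReal.ofReal (∑ i, |c i|)}

end CircuitCutting

open CircuitCutting

/-! Measure-and-prepare maps `X ↦ tr(M X) N`, with `M` an effect and `N` a density matrix, span all
superoperators over `ℂ`, and so do their tensor products (`span_image2_tensor`). All of these
preserve Hermiticity, so averaging an expansion with its conjugate makes the coefficients real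
(`HP_subset_span`). Each nonzero such map is one outcome of an instrument, and 0/1 weights isolate
one product of outcomes. This gives `HP` as the span of `LOStar`.

For `LO` the factors must be channels. Let `D`, `D'` discard one side's input or output and prepare
a fixed state. The map `E ↦ E - D' ∘ E + D' ∘ E ∘ D` fixes every non-signalling `E`: `D' ∘ E` sees
only the other side's output, which `D` cannot influence (`correct_eq_self_left`,
`correct_eq_self_right`). On a product it acts on a single factor and turns a measure-and-prepare
map into a real combination of channels (`correct_mem_span_CPTP`). Applying it on both sides to the
expansion of a non-signalling map leaves that map unchanged and makes every term a combination of
products of channels.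

Finiteness of the extent is membership in the real span. -/

namespace CircuitCutting

/-! ### Measure-and-prepare maps and Hermitian preservation -/

section Superop

variable {m n : Type*} [Fintype m] [Fintype n]

/-- The superoperator `X ↦ tr(M X) N`, bilinear in `M` and `N`. -/
noncomputable def measurePrepare :
    Matrix m m ℂ →ₗ[ℂ] Matrix n n ℂ →ₗ[ℂ] Superop m n :=
  LinearMap.mk₂ ℂ
    (fun M N => ((Matrix.traceLinearMap m ℂ ℂ).comp (LinearMap.mulLeft ℂ M)).smulRight N)
    (fun M M' N => by ext X : 1; simp [add_mul, add_smul])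
    (fun c M N => by ext X : 1; simp [smul_smul])
    (fun M N N' => by ext X : 1; simp)
    (fun c M N => by ext X : 1; simp [smul_smul, mul_comm])

omit [Fintype n] in
@[simp]
theorem measurePrepare_apply (M X : Matrix m m ℂ) (N : Matrix n n ℂ) :
    measurePrepare M N X = (M * X).trace • N := rfl

theorem posSemidef_traceB {a b : Type*} [Fintype a] [Fintype b] {X : Matrix (a × b) (a × b) ℂ}
    (hX : X.PosSemidef) : (traceB X).PosSemidef := by
  have : traceB X = ∑ k, X.submatrix (fun i => (i, k)) (fun i => (i, k)) := by
    ext i j; simp [traceB, Matrix.sum_apply]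
  rw [this]
  exact Matrix.posSemidef_sum _ fun k _ => hX.submatrix _

theorem posSemidef_traceA {a b : Type*} [Fintype a] [Fintype b] {X : Matrix (a × b) (a × b) ℂ}
    (hX : X.PosSemidef) : (traceA X).PosSemidef := by
  have : traceA X = ∑ k, X.submatrix (fun i => (k, i)) (fun i => (k, i)) := by
    ext i j; simp [traceA, Matrix.sum_apply]
  rw [this]
  exact Matrix.posSemidef_sum _ fun k _ => hX.submatrix _

theorem trace_traceA {a b : Type*} [Fintype a] [Fintype b] (X : Matrix (a × b) (a × b) ℂ) :
    (traceA X).trace = X.trace := by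
  simp only [Matrix.trace, traceA, Matrix.diag_apply, Matrix.of_apply, Fintype.sum_prod_type]
  exact Finset.sum_comm

theorem trace_traceB {a b : Type*} [Fintype a] [Fintype b] (X : Matrix (a × b) (a × b) ℂ) :
    (traceB X).trace = X.trace := by
  simp only [Matrix.trace, traceB, Matrix.diag_apply, Matrix.of_apply, Fintype.sum_prod_type]

theorem exists_conjTranspose_mul_self {M : Matrix m m ℂ} (hM : M.PosSemidef) :
    ∃ B : Matrix m m ℂ, M = B.conjTranspose * B := by
  classical
  open scoped MatrixOrder Matrix.Norms.L2Operator in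
  exact CStarAlgebra.nonneg_iff_eq_star_mul_self.1 (Matrix.nonneg_iff_posSemidef.2 hM)

theorem measurePrepare_mem_CP {M : Matrix m m ℂ} {N : Matrix n n ℂ} (hM : M.PosSemidef)
    (hN : N.PosSemidef) : measurePrepare M N ∈ CP m n := by
  intro k X hX
  obtain ⟨B, rfl⟩ := exists_conjTranspose_mul_self hM
  -- With `M = B* B`, `tr(M Y) = tr(B Y B*)`: the ampliation conjugates by `1 ⊗ B`, traces out the
  -- second factor and appends `N`.
  have h : ampliation k (measurePrepare (B.conjTranspose * B) N) X =
      traceB (((1 : Matrix (Fin k) (Fin k) ℂ) ⊗ₖ B) * X *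
        ((1 : Matrix (Fin k) (Fin k) ℂ) ⊗ₖ B).conjTranspose) ⊗ₖ N := by
    ext ⟨i, x⟩ ⟨j, y⟩
    have hT : ∀ Y : Matrix m m ℂ,
        (B.conjTranspose * B * Y).trace = (B * Y * B.conjTranspose).trace := fun Y => by
      rw [Matrix.mul_assoc, Matrix.trace_mul_comm]
    simp only [ampliation, Matrix.of_apply, measurePrepare_apply, Matrix.smul_apply, smul_eq_mul,
      Matrix.kroneckerMap_apply, hT]
    congr 1
    simp [Matrix.trace, traceB, Matrix.mul_apply, Fintype.sum_prod_type, Matrix.one_apply,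
      Finset.sum_mul, apply_ite]
  rw [h]
  exact (posSemidef_traceB (hX.mul_mul_conjTranspose_same _)).kronecker hN

theorem CP_add {E F : Superop m n} (hE : E ∈ CP m n) (hF : F ∈ CP m n) : E + F ∈ CP m n :=
  fun k M hM => (hE k M hM).add (hF k M hM)

theorem CP_posSemidef {E : Superop m n} (hE : E ∈ CP m n) {X : Matrix m m ℂ}
    (hX : X.PosSemidef) : (E X).PosSemidef :=
  (hE 1 (X.submatrix Prod.snd Prod.snd) (hX.submatrix _)).submatrix fun x => (0, x)

variable [DecidableEq m]

/-- Effects: positive semidefinite matrices bounded by the identity. -/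
def IsEffect (M : Matrix m m ℂ) : Prop := M.PosSemidef ∧ (1 - M).PosSemidef

omit [Fintype m] in
theorem isEffect_one : IsEffect (1 : Matrix m m ℂ) :=
  ⟨Matrix.PosSemidef.one, by simpa using Matrix.PosSemidef.zero⟩

theorem exists_isEffect_of_isHermitian {H : Matrix m m ℂ} (hH : H.IsHermitian) :
    ∃ (M : Matrix m m ℂ) (s t : ℝ), IsEffect M ∧ H = s • M + t • (1 : Matrix m m ℂ) := by
  obtain ⟨r, hr, h1, h2⟩ : ∃ r : ℝ, 0 < r ∧ (r • (1 : Matrix m m ℂ) - H).PosSemidef ∧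
      (r • (1 : Matrix m m ℂ) + H).PosSemidef := by
    open scoped MatrixOrder Matrix.Norms.L2Operator in
    have hs : IsSelfAdjoint H := hH
    have h1 := Matrix.le_iff.1 (IsSelfAdjoint.le_algebraMap_norm_self hs)
    have h2 := Matrix.le_iff.1 (IsSelfAdjoint.neg_algebraMap_norm_le_self hs)
    have h3 : (1 : Matrix m m ℂ).PosSemidef := Matrix.PosSemidef.one
    -- The extra 1 keeps `r` positive even when `H = 0`.
    refine ⟨‖H‖ + 1, by positivity, ?_, ?_⟩
    · have e : (‖H‖ + 1) • (1 : Matrix m m ℂ) - H = algebraMap ℝ _ ‖H‖ - H + 1 := by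
        rw [Algebra.algebraMap_eq_smul_one, add_smul, one_smul]; abel
      exact e ▸ h1.add h3
    · have e : (‖H‖ + 1) • (1 : Matrix m m ℂ) + H = H - -algebraMap ℝ _ ‖H‖ + 1 := by
        rw [Algebra.algebraMap_eq_smul_one, add_smul, one_smul]; abel
      exact e ▸ h2.add h3
  have hr' : r ≠ 0 := hr.ne'
  have hr2 : (0 : ℝ) ≤ 1 / (2 * r) := by positivity
  -- The affine map sending `[-r, r]` to `[0, 1]` turns `H` into an effect.
  refine ⟨(1 / (2 * r)) • (r • (1 : Matrix m m ℂ) + H), 2 * r, -r, ⟨h2.smul hr2, ?_⟩, ?_⟩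
  · convert h1.smul hr2 using 1
    have : (1 : Matrix m m ℂ) = (1 / (2 * r)) • ((2 * r) • (1 : Matrix m m ℂ)) := by
      rw [smul_smul, one_div_mul_cancel (by positivity), one_smul]
    nth_rw 1 [this]
    rw [← smul_sub]
    congr 1
    rw [two_mul, add_smul]; abel
  · rw [smul_smul, mul_one_div_cancel (by positivity), one_smul, neg_smul]; abel

omit [Fintype m] [DecidableEq m] in
theorem eq_top_of_isHermitian_mem {p : Submodule ℂ (Matrix m m ℂ)}
    (h : ∀ H : Matrix m m ℂ, H.IsHermitian → H ∈ p) : p = ⊤ := by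
  refine eq_top_iff.2 fun X _ => ?_
  rw [← realPart_add_I_smul_imaginaryPart X]
  exact p.add_mem (h _ (realPart X).2) (p.smul_mem _ (h _ (imaginaryPart X).2))

theorem span_isEffect : Submodule.span ℂ {M : Matrix m m ℂ | IsEffect M} = ⊤ := by
  refine eq_top_of_isHermitian_mem fun H hH => ?_
  obtain ⟨M, s, t, hM, rfl⟩ := exists_isEffect_of_isHermitian hH
  exact Submodule.add_mem _
    ((Submodule.span ℂ _).smul_of_tower_mem s (Submodule.subset_span hM))
    ((Submodule.span ℂ _).smul_of_tower_mem t (Submodule.subset_span isEffect_one))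

omit [DecidableEq m] in
theorem span_isDensity : Submodule.span ℂ {M : Matrix m m ℂ | IsDensity M} = ⊤ := by
  classical
  rw [eq_top_iff, ← span_isEffect, Submodule.span_le]
  rintro M ⟨hM, -⟩
  by_cases h0 : M.trace = 0
  · rw [hM.trace_eq_zero_iff.1 h0]; exact Submodule.zero_mem _
  · have : M = M.trace • (M.trace⁻¹ • M) := by rw [smul_smul, mul_inv_cancel₀ h0, one_smul]
    rw [this]
    refine Submodule.smul_mem _ _ (Submodule.subset_span ⟨hM.smul ?_, ?_⟩)
    · exact inv_nonneg.2 hM.trace_nonneg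
    · simp [h0]

theorem isDensity_single (p : m) : IsDensity (Matrix.single p p (1 : ℂ)) := by
  refine ⟨?_, by simp⟩
  rw [← Matrix.diagonal_single]
  exact Matrix.PosSemidef.diagonal (Pi.single_nonneg.2 zero_le_one)

/-- The measure-and-prepare maps of an effect and a density matrix. -/
def measurePrepareSet (m n : Type*) [Fintype m] [Fintype n] [DecidableEq m] :
    Set (Superop m n) :=
  Set.image2 (fun M N => measurePrepare M N) {M | IsEffect M} {N | IsDensity N}

theorem span_measurePrepareSet : Submodule.span ℂ (measurePrepareSet m n) = ⊤ := by
  classical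
  rw [measurePrepareSet, ← Submodule.map₂_span_span, span_isEffect, span_isDensity, eq_top_iff]
  intro E _
  -- Expansion in matrix units: `tr(e_qp X) = X_pq`.
  have : E = ∑ p, ∑ q, measurePrepare (Matrix.single q p 1) (E (Matrix.single p q 1)) := by
    refine Matrix.ext_linearMap ℂ fun i j => LinearMap.ext_ring ?_
    have h : ∀ p q : m, (Matrix.single q p (1 : ℂ) * Matrix.single i j 1).trace =
        if p = i then (if q = j then 1 else 0) else 0 := fun p q => by
      rw [Matrix.trace_single_mul]
      simp [Matrix.single_apply, ← ite_and, eq_comm]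
    simp [h, ite_smul]
  rw [this]
  exact Submodule.sum_mem _ fun p _ => Submodule.sum_mem _ fun q _ =>
    Submodule.apply_mem_map₂ _ trivial trivial

omit [DecidableEq m] in
theorem CP_subset_HP : CP m n ⊆ HP m n := by
  classical
  intro E hE X hX
  obtain ⟨M, s, t, hM, rfl⟩ := exists_isEffect_of_isHermitian hX
  have h : ∀ (s : ℝ) {Y : Matrix n n ℂ}, Y.IsHermitian → (s • Y).IsHermitian :=
    fun s Y hY => by simp [Matrix.IsHermitian, hY.eq]
  have hs : ∀ (s : ℝ) (Y : Matrix m m ℂ), E (s • Y) = s • E Y := fun s Y =>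
    LinearMap.map_smul_of_tower E s Y
  rw [map_add, hs, hs]
  exact (h s (CP_posSemidef hE hM.1).1).add (h t (CP_posSemidef hE isEffect_one.1).1)

omit [Fintype m] [Fintype n] [DecidableEq m] in
theorem HP_conjTranspose {E : Superop m n} (hE : E ∈ HP m n) (X : Matrix m m ℂ) :
    E X.conjTranspose = (E X).conjTranspose := by
  have h1 := hE _ (realPart X).2
  have h2 := hE _ (imaginaryPart X).2
  have e1 : ((realPart X : Matrix m m ℂ)).conjTranspose = realPart X := (realPart X).2
  have e2 : ((imaginaryPart X : Matrix m m ℂ)).conjTranspose = imaginaryPart X :=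
    (imaginaryPart X).2
  rw [← realPart_add_I_smul_imaginaryPart X]
  simp only [Matrix.conjTranspose_add, Matrix.conjTranspose_smul, map_add, map_smul, e1, e2,
    h1.eq, h2.eq]

omit [Fintype m] [Fintype n] [DecidableEq m] in
/-- If `S` spans all superoperators over `ℂ` and consists of Hermitian-preserving maps, then it
spans the Hermitian-preserving maps over `ℝ`. -/
theorem HP_subset_span {S : Set (Superop m n)} (hS : S ⊆ HP m n)
    (hspan : Submodule.span ℂ S = ⊤) : HP m n ⊆ Submodule.span ℝ S := by
  intro E hE
  obtain ⟨k, c, F, hc⟩ := Submodule.mem_span_set'.1 (hspan ▸ Submodule.mem_top : E ∈ _)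
  have : E = ∑ i, (c i).re • (F i : Superop m n) := by
    ext X : 1
    have h1 : E X = ∑ i, c i • (F i : Superop m n) X := by rw [← hc]; simp
    -- Conjugating `E` by the adjoint changes neither `E` nor the `F i`, only the coefficients;
    -- averaging with `h1` leaves their real parts.
    have h2 : E X = ∑ i, star (c i) • (F i : Superop m n) X := by
      have h := congrArg Matrix.conjTranspose (HP_conjTranspose hE X)
      rw [Matrix.conjTranspose_conjTranspose] at h
      rw [← h, ← hc]
      simp [Matrix.conjTranspose_sum, HP_conjTranspose (hS (F _).2)]
    have h3 : (2 : ℂ) • E X = (2 : ℂ) • ∑ i, (c i).re • (F i : Superop m n) X := by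
      rw [two_smul]
      nth_rw 1 [h1]
      rw [h2, ← Finset.sum_add_distrib, Finset.smul_sum]
      refine Finset.sum_congr rfl fun i _ => ?_
      rw [← add_smul, ← Complex.coe_smul, smul_smul]
      congr 1
      simpa using Complex.add_conj (c i)
    simpa using smul_right_injective _ (two_ne_zero (α := ℂ)) h3
  rw [this]
  exact Submodule.sum_mem _ fun i _ => Submodule.smul_mem _ _ (Submodule.subset_span (F i).2)

end Superop

/-! ### Partial traces of product operators -/

section PartialTrace

variable {a b : Type*}

theorem traceA_kronecker [Fintype a] (X : Matrix a a ℂ) (Y : Matrix b b ℂ) :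
    traceA (X ⊗ₖ Y) = X.trace • Y := by
  ext k l; simp [traceA, Matrix.trace, Finset.sum_mul]

theorem traceB_kronecker [Fintype b] (X : Matrix a a ℂ) (Y : Matrix b b ℂ) :
    traceB (X ⊗ₖ Y) = Y.trace • X := by
  ext k l; simp [traceB, Matrix.trace, ← Finset.mul_sum, mul_comm]

end PartialTrace

/-! ### Tensor products of superoperators -/

section Tensor

variable {a b a' b' : Type*} [Fintype a] [Fintype b] [DecidableEq a] [DecidableEq b]

/-- Linear maps on `L(AB)` that agree on product operators are equal. -/
theorem kronecker_ext {V : Type*} [AddCommMonoid V] [Module ℂ V]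
    {E F : Matrix (a × b) (a × b) ℂ →ₗ[ℂ] V}
    (h : ∀ (X : Matrix a a ℂ) (Y : Matrix b b ℂ), E (X ⊗ₖ Y) = F (X ⊗ₖ Y)) : E = F := by
  refine Matrix.ext_linearMap ℂ fun ⟨p, r⟩ ⟨q, s⟩ => LinearMap.ext_ring ?_
  have := h (Matrix.single p q 1) (Matrix.single r s 1)
  rw [Matrix.single_kronecker_single, one_mul] at this
  exact this

/-- `tensor` as a bilinear map. -/
noncomputable def tensorₗ :
    Superop a a' →ₗ[ℂ] Superop b b' →ₗ[ℂ] Superop (a × b) (a' × b') :=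
  LinearMap.mk₂ ℂ tensor
    (fun E E' F => kronecker_ext fun X Y => by
      simp [tensor_kronecker, Matrix.add_kronecker])
    (fun c E F => kronecker_ext fun X Y => by
      simp [tensor_kronecker, Matrix.smul_kronecker])
    (fun E F F' => kronecker_ext fun X Y => by
      simp [tensor_kronecker, Matrix.kronecker_add])
    (fun c E F => kronecker_ext fun X Y => by
      simp [tensor_kronecker, Matrix.kronecker_smul])

theorem tensorₗ_apply (E : Superop a a') (F : Superop b b') : tensorₗ E F = tensor E F := rfl

theorem tensor_comp {a'' b'' : Type*} [Fintype a'] [Fintype b'] [DecidableEq a'] [DecidableEq b']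
    (E : Superop a a') (F : Superop b b') (E' : Superop a' a'') (F' : Superop b' b'') :
    tensor E' F' ∘ₗ tensor E F = tensor (E' ∘ₗ E) (F' ∘ₗ F) :=
  kronecker_ext fun X Y => by simp [tensor_kronecker]

theorem map_mem_of_kronecker_mem {V : Type*} [AddCommGroup V] [Module ℂ V]
    (f : Matrix (a × b) (a × b) ℂ →ₗ[ℂ] V) {p : Submodule ℂ V}
    (h : ∀ (X : Matrix a a ℂ) (Y : Matrix b b ℂ), f (X ⊗ₖ Y) ∈ p)
    (M : Matrix (a × b) (a × b) ℂ) : f M ∈ p := by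
  -- Membership in `p` is vanishing in the quotient, a linear condition that product operators
  -- detect.
  have : p.mkQ ∘ₗ f = 0 := kronecker_ext fun X Y => by simpa using h X Y
  simpa using LinearMap.congr_fun this M

theorem measurePrepare_kronecker [Fintype a'] [Fintype b'] (M : Matrix a a ℂ) (M' : Matrix b b ℂ)
    (N : Matrix a' a' ℂ) (N' : Matrix b' b' ℂ) :
    measurePrepare (M ⊗ₖ M') (N ⊗ₖ N') = tensor (measurePrepare M N) (measurePrepare M' N') :=
  kronecker_ext fun X Y => by
    simp [tensor_kronecker, ← Matrix.mul_kronecker_mul, Matrix.trace_kronecker,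
      Matrix.smul_kronecker, Matrix.kronecker_smul, smul_smul, mul_comm]

/-- By bilinearity it suffices to reach measure-and-prepare maps whose effect and state are both
Kronecker products, and these factor as tensor products. -/
theorem span_image2_tensor [Fintype a'] [Fintype b'] {S : Set (Superop a a')}
    {T : Set (Superop b b')} (hS : Submodule.span ℂ S = ⊤) (hT : Submodule.span ℂ T = ⊤) :
    Submodule.span ℂ (Set.image2 tensor S T) = ⊤ := by
  classical
  have key := Submodule.map₂_span_span ℂ (tensorₗ (a := a) (b := b) (a' := a') (b' := b')) S T
  change _ = Submodule.span ℂ (Set.image2 tensor S T) at key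
  rw [← key, hS, hT, ← top_le_iff, ← span_measurePrepareSet, Submodule.span_le]
  rintro _ ⟨M, -, N, -, rfl⟩
  refine map_mem_of_kronecker_mem (measurePrepare M) (fun N N' => ?_) N
  refine map_mem_of_kronecker_mem (measurePrepare.flip (N ⊗ₖ N')) (fun M M' => ?_) M
  rw [LinearMap.flip_apply, measurePrepare_kronecker]
  exact Submodule.apply_mem_map₂ tensorₗ trivial trivial

theorem tensor_mem_HP {E : Superop a a'} {F : Superop b b'} (hE : E ∈ HP a a')
    (hF : F ∈ HP b b') : tensor E F ∈ HP (a × b) (a' × b') := by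
  intro X hX
  have h : ∀ p q r s, star (X (p, r) (q, s)) = X (q, s) (p, r) := fun p q r s => hX.apply _ _
  have h1 : ∀ p q, (E (Matrix.single p q 1)).conjTranspose = E (Matrix.single q p 1) :=
    fun p q => by rw [← HP_conjTranspose hE, Matrix.conjTranspose_single, star_one]
  have h2 : ∀ p q, (F (Matrix.single p q 1)).conjTranspose = F (Matrix.single q p 1) :=
    fun p q => by rw [← HP_conjTranspose hF, Matrix.conjTranspose_single, star_one]
  simp only [Matrix.IsHermitian, tensor, LinearMap.coe_mk, AddHom.coe_mk,
    Matrix.conjTranspose_sum, Matrix.conjTranspose_smul, Matrix.conjTranspose_kronecker, h, h1, h2]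
  -- The adjoint swaps `p` with `q` and `r` with `s`; exchanging the sums undoes this.
  rw [Finset.sum_comm]
  exact Finset.sum_congr rfl fun _ _ => Finset.sum_congr rfl fun _ _ => Finset.sum_comm

variable [Fintype a'] [Fintype b']

/-- `traceA` as a linear map. -/
def traceAₗ (a b : Type*) [Fintype a] : Matrix (a × b) (a × b) ℂ →ₗ[ℂ] Matrix b b ℂ where
  toFun := traceA
  map_add' X Y := by ext; simp [traceA, Finset.sum_add_distrib]
  map_smul' c X := by ext; simp [traceA, Finset.mul_sum]

/-- `traceB` as a linear map. -/
def traceBₗ (a b : Type*) [Fintype b] : Matrix (a × b) (a × b) ℂ →ₗ[ℂ] Matrix a a ℂ where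
  toFun := traceB
  map_add' X Y := by ext; simp [traceB, Finset.sum_add_distrib]
  map_smul' c X := by ext; simp [traceB, Finset.mul_sum]

omit [Fintype b'] in
theorem traceA_tensor {E : Superop a a'} (hE : E ∈ TP a a') (F : Superop b b')
    (X : Matrix (a × b) (a × b) ℂ) : traceA (tensor E F X) = F (traceA X) := by
  have : traceAₗ a' b' ∘ₗ tensor E F = F ∘ₗ traceAₗ a b := kronecker_ext fun X Y => by
    simp [traceAₗ, tensor_kronecker, traceA_kronecker, hE X]
  exact LinearMap.congr_fun this X

omit [Fintype a'] in
theorem traceB_tensor (E : Superop a a') {F : Superop b b'} (hF : F ∈ TP b b')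
    (X : Matrix (a × b) (a × b) ℂ) : traceB (tensor E F X) = E (traceB X) := by
  have : traceBₗ a' b' ∘ₗ tensor E F = E ∘ₗ traceBₗ a b := kronecker_ext fun X Y => by
    simp [traceBₗ, tensor_kronecker, traceB_kronecker, hF Y]
  exact LinearMap.congr_fun this X

/-- Discarding the first system and preparing `ω` in its place. -/
theorem tensor_measurePrepare_one_id (ω : Matrix a a ℂ) (X : Matrix (a × b) (a × b) ℂ) :
    tensor (measurePrepare 1 ω) LinearMap.id X = ω ⊗ₖ traceA X := by
  have : tensor (measurePrepare 1 ω) LinearMap.id =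
      (Matrix.kroneckerBilinear (R := ℂ) ω) ∘ₗ traceAₗ a b := kronecker_ext fun X Y => by
    simp [traceAₗ, tensor_kronecker, traceA_kronecker, Matrix.kroneckerBilinear,
      Matrix.smul_kronecker, Matrix.kroneckerMapBilinear]
  exact LinearMap.congr_fun this X

theorem tensor_id_measurePrepare_one (ω : Matrix b b ℂ) (X : Matrix (a × b) (a × b) ℂ) :
    tensor LinearMap.id (measurePrepare 1 ω) X = traceB X ⊗ₖ ω := by
  have : tensor LinearMap.id (measurePrepare 1 ω) =
      (Matrix.kroneckerBilinear (R := ℂ)).flip ω ∘ₗ traceBₗ a b := kronecker_ext fun X Y => by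
    simp [traceBₗ, tensor_kronecker, traceB_kronecker, Matrix.kroneckerBilinear,
      Matrix.kronecker_smul, Matrix.kroneckerMapBilinear]
  exact LinearMap.congr_fun this X

theorem tensor_mem_NSIG {E : Superop a a'} {F : Superop b b'} (hE : E ∈ CPTP a a')
    (hF : F ∈ CPTP b b') : tensor E F ∈ NSIG a b a' b' :=
  ⟨tensor_mem_HP (CP_subset_HP hE.1) (CP_subset_HP hF.1),
    fun ρ σ _ _ h => by rw [traceB_tensor E hF.2, traceB_tensor E hF.2, h],
    fun ρ σ _ _ h => by rw [traceA_tensor hE.2, traceA_tensor hE.2, h]⟩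

omit [DecidableEq a] [DecidableEq b] in
/-- Two linear maps on matrices that agree on density matrices are equal. -/
theorem eq_of_isDensity {V : Type*} [AddCommMonoid V] [Module ℂ V]
    {f g : Matrix a a ℂ →ₗ[ℂ] V} (h : ∀ ρ, IsDensity ρ → f ρ = g ρ) : f = g :=
  LinearMap.ext_on span_isDensity fun ρ hρ => h ρ hρ

/-! ### The correction map and non-signalling maps -/

variable [DecidableEq a'] [DecidableEq b']

/-- The map `E ↦ E - D' ∘ E + D' ∘ E ∘ D`. -/
noncomputable def correct {m n : Type*} (D : Superop m m) (D' : Superop n n) :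
    Superop m n →ₗ[ℂ] Superop m n where
  toFun E := E - D' ∘ₗ E + D' ∘ₗ E ∘ₗ D
  map_add' E F := by
    simp only [LinearMap.comp_add, LinearMap.add_comp]; abel
  map_smul' c E := by
    simp only [LinearMap.comp_smul, LinearMap.smul_comp, smul_add, smul_sub, RingHom.id_apply]

theorem correct_tensor_left (D : Superop a a) (D' : Superop a' a') (E : Superop a a')
    (F : Superop b b') : correct (tensor D LinearMap.id) (tensor D' LinearMap.id) (tensor E F) =
      tensor (correct D D' E) F := by
  simp only [correct, LinearMap.coe_mk, AddHom.coe_mk, tensor_comp, LinearMap.id_comp,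
    LinearMap.comp_id]
  simp only [← tensorₗ_apply, map_add, map_sub, LinearMap.add_apply, LinearMap.sub_apply]

theorem correct_tensor_right (D : Superop b b) (D' : Superop b' b') (E : Superop a a')
    (F : Superop b b') : correct (tensor LinearMap.id D) (tensor LinearMap.id D') (tensor E F) =
      tensor E (correct D D' F) := by
  simp only [correct, LinearMap.coe_mk, AddHom.coe_mk, tensor_comp, LinearMap.id_comp,
    LinearMap.comp_id]
  simp only [← tensorₗ_apply, map_add, map_sub]

/-- The inputs `ρ` and `ω ⊗ tr_A ρ` have the same `B`-marginal, so non-signalling gives outputs with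
equal `B'`-marginals. The last two terms of the correction therefore cancel. -/
theorem correct_eq_self_left {E : Superop (a × b) (a' × b')} (hE : E ∈ NSIG a b a' b')
    {ω : Matrix a a ℂ} (hω : IsDensity ω) (τ : Matrix a' a' ℂ) :
    correct (tensor (measurePrepare 1 ω) LinearMap.id)
      (tensor (measurePrepare 1 τ) LinearMap.id) E = E := by
  have : tensor (measurePrepare 1 τ) LinearMap.id ∘ₗ E =
      tensor (measurePrepare 1 τ) LinearMap.id ∘ₗ E ∘ₗ
        tensor (measurePrepare 1 ω) LinearMap.id := by
    refine eq_of_isDensity fun ρ hρ => ?_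
    simp only [LinearMap.comp_apply, tensor_measurePrepare_one_id]
    rw [hE.2.2 ρ (ω ⊗ₖ traceA ρ) hρ ⟨hω.1.kronecker (posSemidef_traceA hρ.1), ?_⟩ ?_]
    · rw [Matrix.trace_kronecker, hω.2, trace_traceA, hρ.2, one_mul]
    · rw [traceA_kronecker, hω.2, one_smul]
  simp [correct, ← this]

theorem correct_eq_self_right {E : Superop (a × b) (a' × b')} (hE : E ∈ NSIG a b a' b')
    {ω : Matrix b b ℂ} (hω : IsDensity ω) (τ : Matrix b' b' ℂ) :
    correct (tensor LinearMap.id (measurePrepare 1 ω))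
      (tensor LinearMap.id (measurePrepare 1 τ)) E = E := by
  have : tensor LinearMap.id (measurePrepare 1 τ) ∘ₗ E =
      tensor LinearMap.id (measurePrepare 1 τ) ∘ₗ E ∘ₗ
        tensor LinearMap.id (measurePrepare 1 ω) := by
    refine eq_of_isDensity fun ρ hρ => ?_
    simp only [LinearMap.comp_apply, tensor_id_measurePrepare_one]
    rw [hE.2.1 ρ (traceB ρ ⊗ₖ ω) hρ ⟨(posSemidef_traceB hρ.1).kronecker hω.1, ?_⟩ ?_]
    · rw [Matrix.trace_kronecker, hω.2, trace_traceB, hρ.2, one_mul]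
    · rw [traceB_kronecker, hω.2, one_smul]
  simp [correct, ← this]

end Tensor

/-! ### Completing maps to instruments and channels -/

section Instruments

variable {m n : Type*} [Fintype m] [Fintype n]

theorem CPTP_ne_zero [Nonempty m] {E : Superop m n} (hE : E ∈ CPTP m n) : E ≠ 0 := by
  classical
  rintro rfl
  simpa [eq_comm] using hE.2 1

/-- A nonzero completely positive map that is completed to a channel by another one occurs in a
discrete quantum instrument. -/
theorem exists_QI {E F : Superop m n} (hE : E ∈ CP m n) (hF : F ∈ CP m n)
    (hEF : E + F ∈ TP m n) (h0 : E ≠ 0) : ∃ G ∈ QI m n, ∃ i, G.map i = E := by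
  by_cases hF0 : F = 0
  · subst hF0
    rw [add_zero] at hEF
    refine ⟨⟨Unit, inferInstance, fun _ => E⟩, ⟨fun _ => ⟨hE, h0⟩, E, ⟨hE, hEF⟩, fun X => ?_⟩,
      (), rfl⟩
    simp
  · refine ⟨⟨Bool, inferInstance, fun i => cond i E F⟩, ⟨?_, E + F, ⟨CP_add hE hF, hEF⟩,
      fun X => ?_⟩, true, rfl⟩
    · rintro (_ | _)
      exacts [⟨hF, hF0⟩, ⟨hE, h0⟩]
    · simpa using hasSum_fintype fun i : Bool => (cond i E F) X

theorem measurePrepare_mem_QI [DecidableEq m] {E : Superop m n}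
    (hE : E ∈ measurePrepareSet m n) (h0 : E ≠ 0) : ∃ G ∈ QI m n, ∃ i, G.map i = E := by
  obtain ⟨M, hM, N, hN, rfl⟩ := hE
  -- The complementary outcome uses the effect `1 - M` and prepares the same `N`.
  refine exists_QI (measurePrepare_mem_CP hM.1 hN.1) (measurePrepare_mem_CP hM.2 hN.1) ?_ h0
  intro X
  simp [hN.2]

theorem measurePrepareSet_subset_HP [DecidableEq m] : measurePrepareSet m n ⊆ HP m n := by
  rintro _ ⟨M, hM, N, hN, rfl⟩
  exact CP_subset_HP (measurePrepare_mem_CP hM.1 hN.1)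

theorem measurePrepare_one_mem_CPTP [DecidableEq m] {N : Matrix n n ℂ} (hN : IsDensity N) :
    measurePrepare (1 : Matrix m m ℂ) N ∈ CPTP m n :=
  ⟨measurePrepare_mem_CP Matrix.PosSemidef.one hN.1, fun X => by simp [hN.2]⟩

/-- The correction yields `tr(M X) N - tr(M X) τ + M_pp tr(X) τ`. Adding and subtracting `tr(X) τ`
completes the first two terms to the channel that prepares `N` or `τ` according to the outcome. -/
theorem correct_mem_span_CPTP [DecidableEq m] [DecidableEq n] (p : m) {τ : Matrix n n ℂ} (hτ : IsDensity τ)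
    {E : Superop m n} (hE : E ∈ measurePrepareSet m n) :
    correct (measurePrepare 1 (Matrix.single p p 1)) (measurePrepare 1 τ) E ∈
      Submodule.span ℝ (CPTP m n) := by
  classical
  obtain ⟨M, hM, N, hN, rfl⟩ := hE
  have h1 : measurePrepare M N + measurePrepare (1 - M) τ ∈ CPTP m n :=
    ⟨CP_add (measurePrepare_mem_CP hM.1 hN.1) (measurePrepare_mem_CP hM.2 hτ.1), fun X => by
      simp [hN.2, hτ.2]⟩
  have h2 := measurePrepare_one_mem_CPTP (m := m) hτ
  have h3 : correct (measurePrepare 1 (Matrix.single p p 1)) (measurePrepare 1 τ)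
      (measurePrepare M N) = (measurePrepare M N + measurePrepare (1 - M) τ) +
        ((M p p).re - 1) • measurePrepare 1 τ := by
    -- Diagonal entries of a Hermitian matrix are real, so the coefficient is real.
    have hp : ((M p p).re : ℂ) = M p p := hM.1.1.coe_re_apply_self p
    ext X : 1
    simp [correct, Matrix.trace_mul_single, hN.2, sub_smul, ← Complex.coe_smul, hp,
      smul_smul]
    abel
  rw [h3]
  exact Submodule.add_mem _ (Submodule.subset_span h1)
    (Submodule.smul_mem _ _ (Submodule.subset_span h2))

theorem exists_QI_of_CPTP [Nonempty m] {E : Superop m n} (hE : E ∈ CPTP m n) :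
    ∃ G ∈ QI m n, G.SumsTo E := by
  refine ⟨⟨Unit, inferInstance, fun _ => E⟩, ⟨fun _ => ⟨hE.1, CPTP_ne_zero hE⟩, E, hE,
    fun X => ?_⟩, fun X => ?_⟩ <;> simp

end Instruments

/-! ### Local operations and their real spans -/

section Local

variable {a b a' b' : Type*} [Fintype a] [Fintype b] [DecidableEq a] [DecidableEq b]

theorem hasSum_matrix {ι m n : Type*} {f : ι → Matrix m n ℂ} {A : Matrix m n ℂ} :
    HasSum f A ↔ ∀ i j, HasSum (fun k => f k i j) (A i j) :=
  (Pi.hasSum (X := fun _ : m => n → ℂ)).trans (forall_congr' fun _ => Pi.hasSum)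

-- Summable families of complex numbers are absolutely summable, so the entrywise product series
-- converges over pairs.
omit [Fintype a] [Fintype b] [DecidableEq a] [DecidableEq b] in
theorem hasSum_kronecker {ι κ : Type*} {f : ι → Matrix a a' ℂ} {g : κ → Matrix b b' ℂ}
    {A : Matrix a a' ℂ} {B : Matrix b b' ℂ} (hf : HasSum f A) (hg : HasSum g B) :
    HasSum (fun x : ι × κ => f x.1 ⊗ₖ g x.2) (A ⊗ₖ B) := by
  refine hasSum_matrix.2 fun x y => ?_
  simp only [Matrix.kroneckerMap_apply]
  have h1 := hasSum_matrix.1 hf x.1 y.1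
  have h2 := hasSum_matrix.1 hg x.2 y.2
  have h := summable_mul_of_summable_norm h1.summable.norm h2.summable.norm
  have h3 := h1.mul h2 h
  exact h3

theorem SumsTo_tensor {G : Family a a'} {H : Family b b'} {E : Superop a a'} {F : Superop b b'}
    (hG : G.SumsTo E) (hH : H.SumsTo F) : (G.tensor H).SumsTo (tensor E F) := by
  intro X
  have hX : ∀ (E : Superop a a') (F : Superop b b'), tensor E F X = ∑ p, ∑ q, ∑ r, ∑ s,
      X (p, r) (q, s) • (E (Matrix.single p q 1) ⊗ₖ F (Matrix.single r s 1)) := fun E F => rfl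
  change HasSum (fun x : G.ι × H.ι => tensor (G.map x.1) (H.map x.2) X) _
  simp only [hX]
  refine hasSum_sum fun p _ => hasSum_sum fun q _ => hasSum_sum fun r _ => hasSum_sum fun s _ => ?_
  exact (hasSum_kronecker (hG _) (hH _)).const_smul (X (p, r) (q, s))

variable [Fintype a'] [Fintype b']

theorem tensor_mem_LO [Nonempty a] [Nonempty b] {E : Superop a a'} {F : Superop b b'}
    (hE : E ∈ CPTP a a') (hF : F ∈ CPTP b b') : tensor E F ∈ LO a b a' b' := by
  obtain ⟨G, hG, hGE⟩ := exists_QI_of_CPTP hE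
  obtain ⟨H, hH, hHF⟩ := exists_QI_of_CPTP hF
  exact ⟨_, ⟨G, hG, H, hH, rfl⟩, SumsTo_tensor hGE hHF⟩

theorem LO_subset_NSIG : LO a b a' b' ⊆ NSIG a b a' b' := by
  rintro T ⟨_, ⟨G, ⟨-, E, hE, hGE⟩, H, ⟨-, F, hF, hHF⟩, rfl⟩, hT⟩
  -- Uniqueness of sums: a product instrument induces the product of its two channels.
  have : T = tensor E F := LinearMap.ext fun X => (hT X).unique (SumsTo_tensor hGE hHF X)
  exact this ▸ tensor_mem_NSIG hE hF

theorem LO_subset_LOStar : LO a b a' b' ⊆ LOStar a b a' b' := by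
  rintro T ⟨G, hG, hT⟩
  refine ⟨G, hG, fun _ => 1, fun _ => by simp, fun X => ?_⟩
  simpa [Family.weight] using hT X

theorem LOStar_subset_HP : LOStar a b a' b' ⊆ HP (a × b) (a' × b') := by
  rintro T ⟨_, ⟨G, ⟨hG, -⟩, H, ⟨hH, -⟩, rfl⟩, w, -, hT⟩ X hX
  have h1 := hT X
  have h2 : ∀ i, (((G.tensor H).weight w).map i X).conjTranspose =
      ((G.tensor H).weight w).map i X := fun i => by
    have := tensor_mem_HP (CP_subset_HP (hG i.1).1) (CP_subset_HP (hH i.2).1) X hX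
    simp [Family.weight, Family.tensor, this.eq]
  have h3 := h1.matrix_conjTranspose
  simp only [h2] at h3
  exact h3.unique h1

theorem tensor_mem_LOStar {E : Superop a a'} {F : Superop b b'}
    (hE : E ∈ measurePrepareSet a a') (hF : F ∈ measurePrepareSet b b') (hE0 : E ≠ 0)
    (hF0 : F ≠ 0) : tensor E F ∈ LOStar a b a' b' := by
  classical
  obtain ⟨G, hG, i, rfl⟩ := measurePrepare_mem_QI hE hE0
  obtain ⟨H, hH, j, rfl⟩ := measurePrepare_mem_QI hF hF0
  -- The weights are the indicator of the single outcome `(i, j)`.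
  refine ⟨_, ⟨G, hG, H, hH, rfl⟩, fun x : G.ι × H.ι => if x = (i, j) then 1 else 0, fun x => ?_, fun X => ?_⟩
  · dsimp only; split_ifs <;> simp
  · have h := hasSum_single (f := fun x : G.ι × H.ι =>
      (if x = (i, j) then (1 : ℝ) else 0) • tensor (G.map x.1) (H.map x.2) X) (i, j)
      fun x hx => by simp [hx]
    simp only [if_true, one_smul] at h
    exact h

theorem HP_subset_span_image2_tensor : HP (a × b) (a' × b') ⊆
    Submodule.span ℝ (Set.image2 tensor (measurePrepareSet a a') (measurePrepareSet b b')) := by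
  refine HP_subset_span ?_ (span_image2_tensor span_measurePrepareSet span_measurePrepareSet)
  rintro _ ⟨E, hE, F, hF, rfl⟩
  exact tensor_mem_HP (measurePrepareSet_subset_HP hE) (measurePrepareSet_subset_HP hF)

theorem HP_subset_span_LOStar :
    HP (a × b) (a' × b') ⊆ Submodule.span ℝ (LOStar a b a' b') := by
  refine HP_subset_span_image2_tensor.trans (Submodule.span_le.2 ?_)
  rintro _ ⟨E, hE, F, hF, rfl⟩
  by_cases hE0 : E = 0
  · rw [hE0, ← tensorₗ_apply, map_zero]; exact Submodule.zero_mem _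
  by_cases hF0 : F = 0
  · rw [hF0, ← tensorₗ_apply, map_zero]; exact Submodule.zero_mem _
  exact Submodule.subset_span (tensor_mem_LOStar hE hF hE0 hF0)

theorem NSIG_subset_span_LO [Nonempty a] [Nonempty b] [Nonempty a'] [Nonempty b'] :
    NSIG a b a' b' ⊆ Submodule.span ℝ (LO a b a' b') := by
  classical
  intro E hE
  obtain ⟨p⟩ := ‹Nonempty a›
  obtain ⟨q⟩ := ‹Nonempty b›
  obtain ⟨p'⟩ := ‹Nonempty a'›
  obtain ⟨q'⟩ := ‹Nonempty b'›
  have : Nonempty a := ⟨p⟩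
  have : Nonempty b := ⟨q⟩
  have hp' := isDensity_single p'
  have hq' := isDensity_single q'
  -- The corrections on both sides combined: `L` fixes `E` and maps each product of
  -- measure-and-prepare maps into the span of `LO`.
  let L := correct (tensor (LinearMap.id (R := ℂ) (M := Matrix a a ℂ))
      (measurePrepare 1 (Matrix.single q q 1)))
    (tensor (LinearMap.id (R := ℂ) (M := Matrix a' a' ℂ))
      (measurePrepare 1 (Matrix.single q' q' 1))) ∘ₗ
    correct (tensor (measurePrepare 1 (Matrix.single p p 1))
      (LinearMap.id (R := ℂ) (M := Matrix b b ℂ)))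
    (tensor (measurePrepare 1 (Matrix.single p' p' 1))
      (LinearMap.id (R := ℂ) (M := Matrix b' b' ℂ)))
  have hL : L E = E := by
    rw [LinearMap.comp_apply, correct_eq_self_left hE (isDensity_single p),
      correct_eq_self_right hE (isDensity_single q)]
  have key : Submodule.span ℝ (Set.image2 tensor (measurePrepareSet a a')
      (measurePrepareSet b b')) ≤
        (Submodule.span ℝ (LO a b a' b')).comap (L.restrictScalars ℝ) := by
    refine Submodule.span_le.2 ?_
    rintro _ ⟨F, hF, G, hG, rfl⟩
    have h := Submodule.apply_mem_map₂
      (LinearMap.restrictScalars₁₂ ℝ ℝ (tensorₗ (a := a) (b := b) (a' := a') (b' := b')))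
      (correct_mem_span_CPTP p hp' hF) (correct_mem_span_CPTP q hq' hG)
    rw [Submodule.map₂_span_span] at h
    have hsub : Set.image2 tensor (CPTP a a') (CPTP b b') ⊆ LO a b a' b' := by
      rintro _ ⟨F, hF, G, hG, rfl⟩
      exact tensor_mem_LO hF hG
    change L (tensor F G) ∈ Submodule.span ℝ (LO a b a' b')
    rw [LinearMap.comp_apply, correct_tensor_left, correct_tensor_right]
    exact Submodule.span_mono hsub h
  have h := key (HP_subset_span_image2_tensor hE.1)
  change L E ∈ Submodule.span ℝ (LO a b a' b') at h
  rwa [hL] at h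

/-- Hermitian-preserving maps as a real subspace. -/
def HPSubmodule (m n : Type*) : Submodule ℝ (Superop m n) where
  carrier := HP m n
  zero_mem' := fun X _ => by simp
  add_mem' := fun hE hF X hX => (hE X hX).add (hF X hX)
  smul_mem' := fun c E hE X hX => by simp [Matrix.IsHermitian, (hE X hX).eq]

/-- Non-signalling maps as a real subspace. -/
def NSIGSubmodule (a b a' b' : Type*) [Fintype a] [Fintype b] [Fintype a'] [Fintype b'] :
    Submodule ℝ (Superop (a × b) (a' × b')) where
  carrier := NSIG a b a' b'
  zero_mem' := ⟨(HPSubmodule _ _).zero_mem, fun _ _ _ _ _ => rfl, fun _ _ _ _ _ => rfl⟩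
  add_mem' := fun {E F} hE hF => ⟨(HPSubmodule _ _).add_mem hE.1 hF.1,
    fun ρ σ hρ hσ h => by
      have hadd := map_add (traceBₗ a' b')
      change ∀ X Y, traceB (X + Y) = traceB X + traceB Y at hadd
      simp only [LinearMap.add_apply, hadd, hE.2.1 ρ σ hρ hσ h, hF.2.1 ρ σ hρ hσ h],
    fun ρ σ hρ hσ h => by
      have hadd := map_add (traceAₗ a' b')
      change ∀ X Y, traceA (X + Y) = traceA X + traceA Y at hadd
      simp only [LinearMap.add_apply, hadd, hE.2.2 ρ σ hρ hσ h, hF.2.2 ρ σ hρ hσ h]⟩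
  smul_mem' := fun c E hE => ⟨(HPSubmodule _ _).smul_mem c hE.1,
    fun ρ σ hρ hσ h => by
      have hsmul := (traceBₗ a' b').map_smul_of_tower c
      change ∀ X, traceB (c • X) = c • traceB X at hsmul
      simp only [LinearMap.smul_apply, hsmul, hE.2.1 ρ σ hρ hσ h],
    fun ρ σ hρ hσ h => by
      have hsmul := (traceAₗ a' b').map_smul_of_tower c
      change ∀ X, traceA (c • X) = c • traceA X at hsmul
      simp only [LinearMap.smul_apply, hsmul, hE.2.2 ρ σ hρ hσ h]⟩

theorem span_LO [Nonempty a] [Nonempty b] [Nonempty a'] [Nonempty b'] :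
    (Submodule.span ℝ (LO a b a' b') : Set (Superop (a × b) (a' × b'))) = NSIG a b a' b' :=
  Set.Subset.antisymm ((Submodule.span_le (p := NSIGSubmodule a b a' b')).2 LO_subset_NSIG)
    NSIG_subset_span_LO

theorem span_LOStar :
    (Submodule.span ℝ (LOStar a b a' b') : Set (Superop (a × b) (a' × b'))) =
      HP (a × b) (a' × b') :=
  Set.Subset.antisymm ((Submodule.span_le (p := HPSubmodule (a × b) (a' × b'))).2 LOStar_subset_HP)
    HP_subset_span_LOStar

theorem LO_nonempty [Nonempty a] [Nonempty b] [Nonempty a'] [Nonempty b'] :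
    (LO a b a' b').Nonempty := by
  classical
  obtain ⟨p'⟩ := ‹Nonempty a'›
  obtain ⟨q'⟩ := ‹Nonempty b'›
  exact ⟨_, tensor_mem_LO (measurePrepare_one_mem_CPTP (isDensity_single p'))
    (measurePrepare_one_mem_CPTP (isDensity_single q'))⟩

end Local

/-! ### Finiteness of the extent -/

theorem extent_lt_top_iff {m n : Type*} {S : Set (Superop m n)} (hS : S.Nonempty)
    (E : Superop m n) : extent S E < ⊤ ↔ E ∈ Submodule.span ℝ S := by
  constructor
  · intro h
    obtain ⟨t, ⟨k, c, F, -, hF, rfl, -⟩, -⟩ := sInf_lt_iff.1 h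
    exact Submodule.sum_mem _ fun i _ => Submodule.smul_mem _ _ (Submodule.subset_span (hF i))
  · intro h
    obtain ⟨k, c, F, rfl⟩ := Submodule.mem_span_set'.1 h
    obtain ⟨F₀, hF₀⟩ := hS
    -- A term with coefficient zero is prepended because the extent demands at least one term, while
    -- a span representation may be empty.
    refine sInf_lt_iff.2 ⟨_, ⟨k + 1, Fin.cons 0 c, Fin.cons F₀ fun i => F i, by lia,
      fun i => ?_, ?_, rfl⟩, ENNReal.ofReal_lt_top⟩
    · exact Fin.cases hF₀ (fun i => by simp) i
    · simp [Fin.sum_univ_succ]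

end CircuitCutting

open CircuitCutting
theorem mainTheorem1 (a b a' b' : Type*)
    [Fintype a] [Fintype b] [Fintype a'] [Fintype b']
    [DecidableEq a] [DecidableEq b]
    [Nonempty a] [Nonempty b] [Nonempty a'] [Nonempty b'] :
    (Submodule.span ℝ (LO a b a' b') : Set (Superop (a × b) (a' × b'))) = NSIG a b a' b' ∧
    (Submodule.span ℝ (LOStar a b a' b') : Set (Superop (a × b) (a' × b'))) =
      HP (a × b) (a' × b') ∧
    (∀ E : Superop (a × b) (a' × b'), extent (LO a b a' b') E < ⊤ ↔ E ∈ NSIG a b a' b') ∧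
    (∀ E : Superop (a × b) (a' × b'),
      extent (LOStar a b a' b') E < ⊤ ↔ E ∈ HP (a × b) (a' × b')) ∧
    (∀ E ∈ CPTP (a × b) (a' × b'), extent (LOStar a b a' b') E < ⊤) := by
  have h1 := span_LO (a := a) (b := b) (a' := a') (b' := b')
  have h2 := span_LOStar (a := a) (b := b) (a' := a') (b' := b')
  have hLO := LO_nonempty (a := a) (b := b) (a' := a') (b' := b')
  have h4 : ∀ E : Superop (a × b) (a' × b'),
      extent (LOStar a b a' b') E < ⊤ ↔ E ∈ HP (a × b) (a' × b') := fun E => by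
    rw [extent_lt_top_iff (hLO.mono LO_subset_LOStar), ← h2, SetLike.mem_coe]
  refine ⟨h1, h2, fun E => ?_, h4, fun E hE => (h4 E).2 (CP_subset_HP hE.1)⟩
  rw [extent_lt_top_iff hLO, ← h1, SetLike.mem_coe]
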